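/- Let $G$ be a countable discrete group, let $\lambda$ be its left regular representation on $\ell^2(G)$, $(\lambda_s\xi)(t)=\xi(s^{-1}t)$, and let $C_r^*(G)$ be the norm closure of $\mathrm{span}\{\lambda_s : s\in G\}$ in $B(\ell^2(G))$, with the operator space structure inherited from $B(\ell^2(G))$. Then the following are equivalent: 1. $G$ is weakly amenable, i.e. there is a net $(\varphi_i)$ of finitely supported functions $G\to\mathbb{C}$ with $\varphi_i(s)\to 1$ for every $s\in G$, such that the maps $\lambda_s\mapsto\varphi_i(s)\lambda_s$ extend to completely bounded maps $M_{\varphi_i}$ on $C_r^*(G)$ with $\sup_i\|M_{\varphi_i}\|_{cb}<\infty$. 2. $C_r^*(G)$ has a cb-frame, i.e. there are sequences $(x_n)$ in $C_r^*(G)$ and $(f_n)$ in $C_r^*(G)^*$ with $x=\sum_{n=1}^\infty f_n(x)x_n$ (norm convergence of the partial sums) for every $x\in C_r^*(G)$, and $\sup_m\big\|\sum_{n=1}^m x_n\otimes f_n\big\|_{cb}<\infty$, where $(x_n\otimes f_n)(x)=f_n(x)x_n$. 3. $C_r^*(G)$ has the completely bounded approximation property (CBAP), i.e. there is a sequence of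 finite-rank maps $\Phi_k$ on $C_r^*(G)$ with $\sup_k\|\Phi_k\|_{cb}<\infty$ and $\Phi_k(x)\to x$ for every $x\in C_r^*(G)$. -/

import Mathlib

open Filter Topology

universe u

noncomputable section

namespace OperatorSpace

/-! ### Concrete operator spaces: matrix norms and completely bounded maps

An operator space is a linear subspace `X` of `B(H)`, for a complex Hilbert space `H`; the norm of
a matrix over `X` is its norm as an operator on the Hilbert space direct sum `H ⊕ ⋯ ⊕ H`. -/

variable {H : Type*} [NormedAddCommGroup H] [InnerProductSpace ℂ H]

/-- The operator on the Hilbert space `Hⁿ` given by an `n × n` matrix over `B(H)`: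
`(a ξ) i = ∑ j, a i j (ξ j)`. -/
def matrixOp {n : ℕ} (a : Matrix (Fin n) (Fin n) (H →L[ℂ] H)) :
    PiLp 2 (fun _ : Fin n => H) →L[ℂ] PiLp 2 (fun _ : Fin n => H) :=
  (PiLp.continuousLinearEquiv 2 ℂ (fun _ : Fin n => H)).symm.toContinuousLinearMap ∘L
    ContinuousLinearMap.pi fun i => ∑ j, a i j ∘L PiLp.proj 2 (fun _ : Fin n => H) j

theorem matrixOp_apply {n : ℕ} (a : Matrix (Fin n) (Fin n) (H →L[ℂ] H))
    (ξ : PiLp 2 (fun _ : Fin n => H)) (i : Fin n) :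
    matrixOp a ξ i = ∑ j, a i j (ξ j) := by
  simp [matrixOp]

/-- The norm of `Mₙ(X)`, for a subspace `X` of `B(H)`. -/
def matrixNorm {X : Submodule ℂ (H →L[ℂ] H)} {n : ℕ} (x : Matrix (Fin n) (Fin n) X) : ℝ :=
  ‖matrixOp (x.map fun y : X => (y : H →L[ℂ] H))‖

/-- `‖Φ‖_cb ≤ C`: all the amplifications `Φₙ = [Φ (x i j)]` on `Mₙ(X)` have norm at most `C`. -/
def CBNormLE {X : Submodule ℂ (H →L[ℂ] H)} (Φ : X →L[ℂ] X) (C : ℝ) : Prop :=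
  ∀ (n : ℕ) (x : Matrix (Fin n) (Fin n) X), matrixNorm (x.map Φ) ≤ C * matrixNorm x

/-- The partial sum `∑_{k < m} x_k ⊗ f_k`, as a map on `X`. -/
def partialSum {X : Submodule ℂ (H →L[ℂ] H)} (x : ℕ → X) (f : ℕ → (X →L[ℂ] ℂ)) (m : ℕ) :
    X →L[ℂ] X :=
  ∑ k ∈ Finset.range m, (f k).smulRight (x k)

/-- `(x_n, f_n)` is a cb-frame of the operator space `X`: `y = ∑ f_n(y) x_n` (norm convergent
series) for all `y ∈ X`, and the partial sums are uniformly completely bounded. -/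
structure IsCBFrame {X : Submodule ℂ (H →L[ℂ] H)} (x : ℕ → X) (f : ℕ → (X →L[ℂ] ℂ)) : Prop where
  tendsto_sum : ∀ y : X,
    Tendsto (fun m : ℕ => ∑ k ∈ Finset.range m, f k y • x k) atTop (𝓝 y)
  bounded : ∃ C : ℝ, ∀ m : ℕ, CBNormLE (partialSum x f m) C

/-- The operator space `X` has a cb-frame. -/
def HasCBFrame (X : Submodule ℂ (H →L[ℂ] H)) : Prop :=
  ∃ (x : ℕ → X) (f : ℕ → (X →L[ℂ] ℂ)), IsCBFrame x f

/-- The completely bounded approximation property of a separable operator space. -/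
def HasCBAP (X : Submodule ℂ (H →L[ℂ] H)) : Prop :=
  ∃ Φ : ℕ → (X →L[ℂ] X),
    (∀ k, FiniteDimensional ℂ (LinearMap.range (Φ k : X →ₗ[ℂ] X))) ∧
    (∃ C : ℝ, ∀ k, CBNormLE (Φ k) C) ∧
    ∀ y : X, Tendsto (fun k => Φ k y) atTop (𝓝 y)

end OperatorSpace

namespace ReducedGroup

variable (G : Type u) [Group G]

/-- The Hilbert space `ℓ²(G)`. -/
abbrev ell2 : Type u := lp (fun _ : G => ℂ) 2

variable {G}

theorem memlp_translate (s : G) (ξ : ell2 G) :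
    Memℓp (fun t : G => ξ (s⁻¹ * t)) 2 := by
  have h := (memℓp_gen_iff (p := 2) (by norm_num)).1 (lp.memℓp ξ)
  exact (memℓp_gen_iff (p := 2) (by norm_num)).2
    ((Equiv.mulLeft s⁻¹).summable_iff.2 h)

/-- The left regular representation: `(lam s ξ)(t) = ξ(s⁻¹ t)` on `ℓ²(G)`. -/
def lam (s : G) : ell2 G →L[ℂ] ell2 G :=
  LinearMap.mkContinuous
    { toFun := fun ξ => ⟨fun t => ξ (s⁻¹ * t), memlp_translate s ξ⟩
      map_add' := fun _ _ => rfl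
      map_smul' := fun _ _ => rfl } 1 (by
    intro ξ
    rw [one_mul, lp.norm_eq_tsum_rpow (p := 2) (by norm_num),
      lp.norm_eq_tsum_rpow (p := 2) (by norm_num)]
    exact le_of_eq (congrArg (fun r : ℝ => r ^ (1 / (2 : ENNReal).toReal))
      ((Equiv.mulLeft s⁻¹).tsum_eq fun t => ‖ξ t‖ ^ (2 : ENNReal).toReal)))

theorem lam_apply (s : G) (ξ : ell2 G) (t : G) : lam s ξ t = ξ (s⁻¹ * t) := rfl

variable (G) in
/-- The reduced group C*-algebra: the norm closure in `B(ℓ²(G))` of the span of the operators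
`lam s`, with the operator space structure that it inherits from `B(ℓ²(G))`. -/
def reducedCStar : Submodule ℂ (ell2 G →L[ℂ] ell2 G) :=
  (Submodule.span ℂ (Set.range (lam : G → ell2 G →L[ℂ] ell2 G))).topologicalClosure

/-- `lam s` as an element of the reduced group C*-algebra. -/
def lamC (s : G) : reducedCStar G :=
  ⟨lam s, Submodule.le_topologicalClosure _ (Submodule.subset_span ⟨s, rfl⟩)⟩

/-- `φ` is a completely bounded (Herz-Schur) multiplier of `G`, of norm at most `C`: the map
`lam s ↦ φ(s) lam s` extends to a completely bounded map on the reduced group C*-algebra, of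
cb-norm at most `C`. -/
def MultiplierNormLE (φ : G → ℂ) (C : ℝ) : Prop :=
  ∃ M : reducedCStar G →L[ℂ] reducedCStar G,
    (∀ s, M (lamC s) = φ s • lamC s) ∧ OperatorSpace.CBNormLE M C

variable (G) in
/-- Weak amenability of the discrete group `G`: there is a net of finitely supported functions
on `G` that converges pointwise to `1` and is bounded in the norm of completely bounded
multipliers. -/
def IsWeaklyAmenable : Prop :=
  ∃ (I : Type u) (_ : Preorder I) (_ : IsDirectedOrder I) (_ : Nonempty I) (φ : I → G → ℂ),
    (∀ i, (Function.support (φ i)).Finite) ∧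
    (∃ C : ℝ, ∀ i, MultiplierNormLE (φ i) C) ∧
    ∀ s, Tendsto (fun i => φ i s) atTop (𝓝 1)

end ReducedGroup

end

/-! From a cb-frame to the CBAP, take the partial sums. For the converse (`HasCBAP.hasCBFrame`),
telescope the approximants and cut each finite-rank difference `A` into rank one maps. Their
intermediate sums may have a large cb-norm, so each rank one term is divided by a large `N` and the
whole list is repeated `N` times. Every partial sum within the block is then `c • A` with `0 ≤ c ≤
1`, up to a small error (`exists_splitting`).

From the CBAP to weak amenability, use Haagerup's averaging: `φ s = ⟨δ_s, Φ (λ_s) δ_1⟩` is a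
multiplier with the cb bound of `Φ` (`multiplierNormLE_of_cbNormLE`). In matrix form, replacing the
scalar entries `⟨δ_r, x δ_t⟩` by multiples of `λ_{r t⁻¹}` does not increase the norm; applying `Φ`
and testing on basis vectors recovers the multiplier. A small cb perturbation of `Φ` first makes `φ`
finitely supported.

Conversely, finitely supported multipliers have finite rank. Countability of `G` extracts a sequence
from the net, and boundedness with density of the span of the `λ_s` gives convergence everywhere. -/

noncomputable section

/-! ### Matrix norms as sesquilinear form bounds, and the calculus of cb-norms. -/

namespace OperatorSpace

variable {H : Type*} [NormedAddCommGroup H] [InnerProductSpace ℂ H]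

/-- The Hilbert space norm of a finite family of vectors. -/
def familyNorm {ι E : Type*} [Fintype ι] [NormedAddCommGroup E] (ξ : ι → E) : ℝ :=
  √(∑ i, ‖ξ i‖ ^ 2)

theorem familyNorm_nonneg {ι E : Type*} [Fintype ι] [NormedAddCommGroup E] (ξ : ι → E) :
    0 ≤ familyNorm ξ := Real.sqrt_nonneg _

theorem familyNorm_sq {ι E : Type*} [Fintype ι] [NormedAddCommGroup E] (ξ : ι → E) :
    familyNorm ξ ^ 2 = ∑ i, ‖ξ i‖ ^ 2 :=
  Real.sq_sqrt (Finset.sum_nonneg fun _ _ => sq_nonneg _)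

theorem familyNorm_congr {ι κ E F : Type*} [Fintype ι] [Fintype κ] [NormedAddCommGroup E]
    [NormedAddCommGroup F] {ξ : ι → E} {η : κ → F}
    (h : ∑ i, ‖ξ i‖ ^ 2 = ∑ i, ‖η i‖ ^ 2) : familyNorm ξ = familyNorm η := by
  rw [familyNorm, familyNorm, h]

theorem familyNorm_le {ι E : Type*} [Fintype ι] [NormedAddCommGroup E] {ξ : ι → E} {c : ℝ}
    (hc : 0 ≤ c) (h : ∑ i, ‖ξ i‖ ^ 2 ≤ c ^ 2) : familyNorm ξ ≤ c :=
  Real.sqrt_le_iff.2 ⟨hc, h⟩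

theorem familyNorm_smul_const {ι : Type*} [Fintype ι] (α : ι → ℂ) (g : H) :
    familyNorm (fun i => α i • g) = familyNorm α * ‖g‖ := by
  have h : ∑ i, ‖α i • g‖ ^ 2 = (∑ i, ‖α i‖ ^ 2) * ‖g‖ ^ 2 := by
    simp [norm_smul, mul_pow, Finset.sum_mul]
  rw [familyNorm, familyNorm, h, Real.sqrt_mul' _ (sq_nonneg _), Real.sqrt_sq (norm_nonneg g)]

theorem familyNorm_map_le {ι : Type*} [Fintype ι] (y : H →L[ℂ] H) (ξ : ι → H) :
    familyNorm (fun i => y (ξ i)) ≤ ‖y‖ * familyNorm ξ := by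
  refine familyNorm_le (mul_nonneg (norm_nonneg _) (familyNorm_nonneg _)) ?_
  rw [mul_pow, familyNorm_sq, Finset.mul_sum]
  gcongr with i
  rw [← mul_pow]
  gcongr
  exact y.le_opNorm _

/-- The matrix `a` over `B(H)` has norm at most `K`, in terms of its sesquilinear form. -/
def FormBound {ι : Type*} [Fintype ι] (a : Matrix ι ι (H →L[ℂ] H)) (K : ℝ) : Prop :=
  ∀ ξ η : ι → H, ‖∑ i, ∑ j, inner ℂ (η i) (a i j (ξ j))‖ ≤ K * (familyNorm ξ * familyNorm η)

theorem inner_matrixOp {n : ℕ} (a : Matrix (Fin n) (Fin n) (H →L[ℂ] H))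
    (ξ η : PiLp 2 (fun _ : Fin n => H)) :
    inner ℂ η (matrixOp a ξ) = ∑ i, ∑ j, inner ℂ (η i) (a i j (ξ j)) := by
  simp [PiLp.inner_apply, matrixOp_apply, inner_sum]

theorem familyNorm_eq_norm {n : ℕ} {E : Type*} [NormedAddCommGroup E]
    (ξ : PiLp 2 (fun _ : Fin n => E)) :
    familyNorm (fun i => ξ i) = ‖ξ‖ := by
  rw [PiLp.norm_eq_of_L2, familyNorm]

theorem formBound_iff {n : ℕ} (a : Matrix (Fin n) (Fin n) (H →L[ℂ] H)) {K : ℝ} (hK : 0 ≤ K) :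
    FormBound a K ↔ ‖matrixOp a‖ ≤ K := by
  constructor
  · intro h
    refine ContinuousLinearMap.opNorm_le_bound _ hK fun ξ => ?_
    -- Testing against `η = a ξ` gives `‖a ξ‖² ≤ K ‖ξ‖ ‖a ξ‖`; one factor cancels unless it
    -- vanishes.
    have h1 := h (fun i => ξ i) (fun i => matrixOp a ξ i)
    rw [← inner_matrixOp, familyNorm_eq_norm, familyNorm_eq_norm, inner_self_eq_norm_sq_to_K] at h1
    rcases (norm_nonneg (matrixOp a ξ)).eq_or_lt with h0 | h0
    · rw [← h0]; positivity
    · refine le_of_mul_le_mul_right ?_ h0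
      simpa [pow_two, mul_assoc] using h1
  · intro h ξ η
    have h1 := inner_matrixOp a (WithLp.toLp 2 ξ) (WithLp.toLp 2 η)
    have h2 := familyNorm_eq_norm (WithLp.toLp 2 ξ)
    have h3 := familyNorm_eq_norm (WithLp.toLp 2 η)
    simp only at h1 h2 h3
    rw [← h1, h2, h3]
    refine (norm_inner_le_norm _ _).trans ?_
    have := (matrixOp a).le_of_opNorm_le h (WithLp.toLp 2 ξ)
    calc _ ≤ ‖WithLp.toLp 2 η‖ * (K * ‖WithLp.toLp 2 ξ‖) := by gcongr
      _ = _ := by ring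

variable {X : Submodule ℂ (H →L[ℂ] H)}

theorem matrixNorm_nonneg {n : ℕ} (x : Matrix (Fin n) (Fin n) X) : 0 ≤ matrixNorm x := by
  exact norm_nonneg (matrixOp (x.map fun y : X => (y : H →L[ℂ] H)))

/-- The matrix `x` over `X`, as a matrix over `B(H)`. -/
def coeMatrix {ι : Type*} (x : Matrix ι ι X) : Matrix ι ι (H →L[ℂ] H) :=
  x.map fun y : X => (y : H →L[ℂ] H)

theorem matrixNorm_le_iff {n : ℕ} (x : Matrix (Fin n) (Fin n) X) {K : ℝ} (hK : 0 ≤ K) :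
    matrixNorm x ≤ K ↔ FormBound (coeMatrix x) K :=
  (formBound_iff _ hK).symm

theorem formBound_matrixNorm {n : ℕ} (x : Matrix (Fin n) (Fin n) X) :
    FormBound (coeMatrix x) (matrixNorm x) :=
  (matrixNorm_le_iff x (matrixNorm_nonneg x)).1 le_rfl

theorem FormBound.reindex {ι κ : Type*} [Fintype ι] [Fintype κ] (e : κ ≃ ι)
    {a : Matrix ι ι (H →L[ℂ] H)} {K : ℝ} (h : FormBound a K) :
    FormBound (fun i j => a (e i) (e j) : Matrix κ κ (H →L[ℂ] H)) K := by
  intro ξ η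
  have h1 := h (ξ ∘ e.symm) (η ∘ e.symm)
  have h2 : ∀ ζ : κ → H, familyNorm (ζ ∘ e.symm) = familyNorm ζ := fun ζ =>
    familyNorm_congr (e.symm.sum_comp fun i => ‖ζ i‖ ^ 2)
  rw [h2, h2, ← e.sum_comp] at h1
  convert h1 using 4 with i
  rw [← e.sum_comp]
  simp

/-- Transport along a bijection with `Fin n` frees the index type, so that matrices over `Unit` and
over `κ × F` can be used directly. -/
theorem CBNormLE.formBound {Φ : X →L[ℂ] X} {C : ℝ} (h : CBNormLE Φ C) (hC : 0 ≤ C)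
    {ι : Type*} [Fintype ι] {x : Matrix ι ι X} {K : ℝ} (hK : 0 ≤ K)
    (hx : FormBound (coeMatrix x) K) : FormBound (coeMatrix (x.map Φ)) (C * K) := by
  let e := Fintype.equivFin ι
  let y : Matrix (Fin (Fintype.card ι)) (Fin (Fintype.card ι)) X :=
    fun i j => x (e.symm i) (e.symm j)
  have h1 : matrixNorm y ≤ K := (matrixNorm_le_iff y hK).2 (hx.reindex e.symm)
  have h2 : matrixNorm (y.map Φ) ≤ C * K := (h _ y).trans (by gcongr)
  have h3 := ((matrixNorm_le_iff _ (by positivity)).1 h2).reindex e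
  have h4 : (fun i j => coeMatrix (y.map Φ) (e i) (e j) : Matrix ι ι (H →L[ℂ] H)) =
      coeMatrix (x.map Φ) := by
    funext i j
    change ((Φ (x (e.symm (e i)) (e.symm (e j))) : X) : H →L[ℂ] H) = Φ (x i j)
    rw [e.symm_apply_apply, e.symm_apply_apply]
  rwa [h4] at h3

theorem CBNormLE.mono {Φ : X →L[ℂ] X} {C D : ℝ} (h : CBNormLE Φ C) (hCD : C ≤ D) :
    CBNormLE Φ D := fun n x =>
  (h n x).trans (mul_le_mul_of_nonneg_right hCD (matrixNorm_nonneg x))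

theorem matrixNorm_add_le {n : ℕ} (x y : Matrix (Fin n) (Fin n) X) :
    matrixNorm (x + y) ≤ matrixNorm x + matrixNorm y := by
  refine (matrixNorm_le_iff _ (add_nonneg (matrixNorm_nonneg _) (matrixNorm_nonneg _))).2 ?_
  intro ξ η
  have := (norm_add_le _ _).trans
    (add_le_add (formBound_matrixNorm x ξ η) (formBound_matrixNorm y ξ η))
  rw [← add_mul] at this
  refine le_of_eq_of_le (congrArg _ ?_) this
  simp [coeMatrix, Finset.sum_add_distrib]

theorem matrixNorm_smul_le {n : ℕ} (c : ℂ) (x : Matrix (Fin n) (Fin n) X) :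
    matrixNorm (c • x) ≤ ‖c‖ * matrixNorm x := by
  refine (matrixNorm_le_iff _ (mul_nonneg (norm_nonneg _) (matrixNorm_nonneg _))).2 ?_
  intro ξ η
  have := mul_le_mul_of_nonneg_left (formBound_matrixNorm x ξ η) (norm_nonneg c)
  rw [← norm_mul, ← mul_assoc] at this
  refine le_of_eq_of_le (congrArg _ ?_) this
  simp [coeMatrix, Finset.mul_sum]

theorem CBNormLE.add {Φ Ψ : X →L[ℂ] X} {C D : ℝ} (h : CBNormLE Φ C) (h' : CBNormLE Ψ D) :
    CBNormLE (Φ + Ψ) (C + D) := by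
  intro n x
  have : x.map ⇑(Φ + Ψ) = x.map Φ + x.map Ψ := by
    refine Matrix.ext fun i j => ?_
    simp
  rw [this, add_mul]
  exact (matrixNorm_add_le _ _).trans (add_le_add (h n x) (h' n x))

theorem CBNormLE.smul {Φ : X →L[ℂ] X} {C : ℝ} (h : CBNormLE Φ C) (c : ℂ) :
    CBNormLE (c • Φ) (‖c‖ * C) := by
  intro n x
  have : x.map ⇑(c • Φ) = c • x.map Φ := by
    refine Matrix.ext fun i j => ?_
    simp
  rw [this, mul_assoc]
  exact (matrixNorm_smul_le _ _).trans (mul_le_mul_of_nonneg_left (h n x) (norm_nonneg c))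

theorem cbNormLE_zero : CBNormLE (0 : X →L[ℂ] X) 0 := by
  intro n x
  rw [zero_mul]
  refine (matrixNorm_le_iff _ le_rfl).2 fun ξ η => ?_
  simp [coeMatrix]

theorem CBNormLE.sub {Φ Ψ : X →L[ℂ] X} {C D : ℝ} (h : CBNormLE Φ C) (h' : CBNormLE Ψ D) :
    CBNormLE (Φ - Ψ) (C + D) := by
  have := h.add (h'.smul (-1))
  rw [norm_neg, norm_one, one_mul] at this
  convert this using 1
  refine ContinuousLinearMap.ext fun y => ?_
  change Φ y - Ψ y = Φ y + (-1 : ℂ) • Ψ y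
  exact (sub_eq_add_neg _ _).trans (congrArg _ (neg_one_smul ℂ (Ψ y)).symm)

theorem CBNormLE.sum {ι : Type*} {s : Finset ι} {Φ : ι → X →L[ℂ] X} {C : ι → ℝ}
    (h : ∀ i ∈ s, CBNormLE (Φ i) (C i)) : CBNormLE (∑ i ∈ s, Φ i) (∑ i ∈ s, C i) := by
  classical
  induction s using Finset.induction_on with
  | empty => simpa using cbNormLE_zero
  | insert a s ha ih =>
    rw [Finset.sum_insert ha, Finset.sum_insert ha]
    exact (h a (by simp)).add (ih fun i hi => h i (by simp [hi]))

theorem formBound_unique_iff (a : H →L[ℂ] H) {K : ℝ} (hK : 0 ≤ K) :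
    FormBound (fun _ _ => a : Matrix Unit Unit (H →L[ℂ] H)) K ↔ ‖a‖ ≤ K := by
  constructor
  · intro h
    refine ContinuousLinearMap.opNorm_le_bound _ hK fun g => ?_
    have h1 := h (fun _ => g) (fun _ => a g)
    simp only [Finset.univ_unique, Finset.sum_singleton, familyNorm, inner_self_eq_norm_sq_to_K,
      Real.sqrt_sq (norm_nonneg _)] at h1
    rcases (norm_nonneg (a g)).eq_or_lt with h0 | h0
    · rw [← h0]; positivity
    · refine le_of_mul_le_mul_right ?_ h0
      simpa [pow_two, mul_assoc] using h1
  · intro h ξ η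
    simp only [Finset.univ_unique, Finset.sum_singleton, familyNorm,
      Real.sqrt_sq (norm_nonneg _)]
    refine (norm_inner_le_norm _ _).trans ?_
    have := a.le_of_opNorm_le h (ξ default)
    calc _ ≤ ‖η default‖ * (K * ‖ξ default‖) := by gcongr
      _ = _ := by ring

theorem CBNormLE.norm_apply_le {Φ : X →L[ℂ] X} {C : ℝ} (h : CBNormLE Φ C) (hC : 0 ≤ C) (y : X) :
    ‖Φ y‖ ≤ C * ‖y‖ := by
  have h1 : FormBound (coeMatrix (fun _ _ => y : Matrix Unit Unit X)) ‖y‖ :=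
    (formBound_unique_iff (y : H →L[ℂ] H) (norm_nonneg y)).2 le_rfl
  exact (formBound_unique_iff (Φ y : H →L[ℂ] H) (by positivity)).1
    (h.formBound hC (norm_nonneg y) h1)

/-- A scalar matrix keeps its norm when it acts on vectors with entries in a Hilbert space. -/
theorem scalar_amplification {ι : Type*} [Fintype ι] (c : ι → ι → ℂ) {K : ℝ} (hK : 0 ≤ K)
    (hc : ∀ α β : ι → ℂ,
      ‖∑ i, ∑ j, star (β i) * α j * c i j‖ ≤ K * (familyNorm α * familyNorm β))
    (ξ η : ι → H) :
    ‖∑ i, ∑ j, c i j * inner ℂ (η i) (ξ j)‖ ≤ K * (familyNorm ξ * familyNorm η) := by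
  -- All vectors lie in a finite-dimensional space. In an orthonormal basis of it the form splits
  -- into one scalar form per coordinate, and Cauchy-Schwarz over the coordinates recombines the
  -- bounds.
  let V : Submodule ℂ H := Submodule.span ℂ (Set.range ξ ∪ Set.range η)
  have : FiniteDimensional ℂ V :=
    FiniteDimensional.span_of_finite ℂ ((Set.finite_range ξ).union (Set.finite_range η))
  let ξ' : ι → V := fun i => ⟨ξ i, Submodule.subset_span (Or.inl ⟨i, rfl⟩)⟩
  let η' : ι → V := fun i => ⟨η i, Submodule.subset_span (Or.inr ⟨i, rfl⟩)⟩
  let b := stdOrthonormalBasis ℂ V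
  let α : Fin (Module.finrank ℂ V) → ι → ℂ := fun k i => inner ℂ (b k) (ξ' i)
  let β : Fin (Module.finrank ℂ V) → ι → ℂ := fun k i => inner ℂ (b k) (η' i)
  have hin : ∀ i j, inner ℂ (η i) (ξ j) = ∑ k, star (β k i) * α k j := by
    intro i j
    rw [show inner ℂ (η i) (ξ j) = inner ℂ (η' i) (ξ' j) from rfl, ← b.sum_inner_mul_inner]
    simp [α, β]
  have hsq : ∀ ζ : ι → V,
      ∑ k, familyNorm (fun i => inner ℂ (b k) (ζ i)) ^ 2 = familyNorm ζ ^ 2 := by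
    intro ζ
    simp_rw [familyNorm_sq]
    rw [Finset.sum_comm]
    exact Finset.sum_congr rfl fun i _ => b.sum_sq_norm_inner_right (ζ i)
  have hsum : ∑ i, ∑ j, c i j * inner ℂ (η i) (ξ j) =
      ∑ k, ∑ i, ∑ j, star (β k i) * α k j * c i j := by
    rw [Finset.sum_comm (γ := Fin _)]
    refine Finset.sum_congr rfl fun i _ => ?_
    rw [Finset.sum_comm (γ := Fin _)]
    refine Finset.sum_congr rfl fun j _ => ?_
    rw [hin, Finset.mul_sum]
    exact Finset.sum_congr rfl fun k _ => by ring
  rw [hsum]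
  calc _ ≤ ∑ k, K * (familyNorm (α k) * familyNorm (β k)) := norm_sum_le_of_le _ fun k _ => hc _ _
    _ = K * ∑ k, familyNorm (α k) * familyNorm (β k) := (Finset.mul_sum _ _ _).symm
    _ ≤ K * (√(∑ k, familyNorm (α k) ^ 2) * √(∑ k, familyNorm (β k) ^ 2)) := by
      gcongr
      exact Real.sum_mul_le_sqrt_mul_sqrt _ _ _
    _ = K * (familyNorm ξ * familyNorm η) := by
      rw [hsq ξ', hsq η', Real.sqrt_sq (familyNorm_nonneg _), Real.sqrt_sq (familyNorm_nonneg _)]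
      rfl

/-- Evaluate the form of `x` on the families `α j • g` and `β i • h`. Applying a functional to this
combination bounds the scalar matrix of its values on the entries of `x`. -/
theorem norm_sum_smul_le {ι : Type*} [Fintype ι] {x : Matrix ι ι X} {K : ℝ} (hK : 0 ≤ K)
    (hx : FormBound (coeMatrix x) K) (α β : ι → ℂ) :
    ‖∑ i, ∑ j, (star (β i) * α j) • x i j‖ ≤ K * (familyNorm α * familyNorm β) := by
  have hn : 0 ≤ K * (familyNorm α * familyNorm β) :=
    mul_nonneg hK (mul_nonneg (familyNorm_nonneg _) (familyNorm_nonneg _))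
  refine (formBound_unique_iff _ hn).1 fun ξ η => ?_
  have h := hx (fun i => α i • ξ ()) (fun i => β i • η ())
  rw [familyNorm_smul_const, familyNorm_smul_const] at h
  simp only [Finset.univ_unique, Finset.sum_singleton, familyNorm, Real.sqrt_sq (norm_nonneg _)]
    at h ⊢
  refine (le_of_eq ?_).trans (h.trans (le_of_eq ?_))
  · refine congrArg _ ?_
    have h1 : ((∑ i, ∑ j, (star (β i) * α j) • x i j : X) : H →L[ℂ] H) (ξ ()) =
        ∑ i, ∑ j, (star (β i) * α j) • (x i j : H →L[ℂ] H) (ξ ()) := by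
      simp [sum_apply]
    refine (congrArg _ h1).trans ?_
    simp only [inner_sum, inner_smul_left, inner_smul_right, map_smul, coeMatrix, Matrix.map_apply]
    refine Finset.sum_congr rfl fun i _ => Finset.sum_congr rfl fun j _ => ?_
    rw [← starRingEnd_apply]; ring
  · simp only [PUnit.default_eq_unit]; ring

theorem exists_bound_of_continuous {E F : Type*} [NormedAddCommGroup E] [NormedSpace ℂ E]
    [NormedAddCommGroup F] [NormedSpace ℂ F] (g : E →ₗ[ℂ] F) (hg : Continuous g) :
    ∃ B : ℝ, 0 ≤ B ∧ ∀ y, ‖g y‖ ≤ B * ‖y‖ :=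
  ⟨_, norm_nonneg (⟨g, hg⟩ : E →L[ℂ] F), (⟨g, hg⟩ : E →L[ℂ] F).le_opNorm⟩

theorem exists_bound (f : X →L[ℂ] ℂ) : ∃ B : ℝ, 0 ≤ B ∧ ∀ y, ‖f y‖ ≤ B * ‖y‖ := by
  have h := exists_bound_of_continuous (E := X) (F := ℂ)
    { toFun := f, map_add' := f.map_add, map_smul' := f.map_smul } f.continuous
  exact h

/-- Rank one maps are completely bounded. -/
theorem cbNormLE_smulRight {f : X →L[ℂ] ℂ} {B : ℝ} (hB : 0 ≤ B) (hf : ∀ y, ‖f y‖ ≤ B * ‖y‖)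
    (y : X) : CBNormLE (f.smulRight y) (B * ‖y‖) := by
  intro n x
  have hx := matrixNorm_nonneg x
  refine (matrixNorm_le_iff _ (by positivity)).2 fun ξ η => ?_
  have h := scalar_amplification (fun i j => f (x i j)) (K := B * matrixNorm x) (by positivity)
    (fun α β => by
      have h1 := (hf _).trans
        (mul_le_mul_of_nonneg_left (norm_sum_smul_le hx (formBound_matrixNorm x) α β) hB)
      rw [mul_assoc]
      simpa using h1) (fun i => (y : H →L[ℂ] H) (ξ i)) η
  have h2 := familyNorm_map_le (y : H →L[ℂ] H) ξ
  have h3 := familyNorm_nonneg η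
  calc _ = ‖∑ i, ∑ j, f (x i j) * inner ℂ (η i) ((y : H →L[ℂ] H) (ξ j))‖ := by
        simp [coeMatrix]
    _ ≤ _ := h
    _ ≤ B * matrixNorm x * (‖(y : H →L[ℂ] H)‖ * familyNorm ξ * familyNorm η) := by gcongr
    _ = _ := by rw [Submodule.coe_norm]; ring

end OperatorSpace

/-! ### The CBAP and cb-frames in an arbitrary operator space. -/

namespace OperatorSpace

variable {H : Type*} [NormedAddCommGroup H] [InnerProductSpace ℂ H]
variable {X : Submodule ℂ (H →L[ℂ] H)}

theorem partialSum_apply (x : ℕ → X) (f : ℕ → (X →L[ℂ] ℂ)) (m : ℕ) (y : X) :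
    partialSum x f m y = ∑ k ∈ Finset.range m, f k y • x k := by
  simp [partialSum, sum_apply]

theorem finiteDimensional_range_of_forall_mem {E F : Type*} [AddCommGroup E] [Module ℂ E]
    [AddCommGroup F] [Module ℂ F] (T : E →ₗ[ℂ] F) (V : Submodule ℂ F) [FiniteDimensional ℂ V]
    (h : ∀ y, T y ∈ V) : FiniteDimensional ℂ (LinearMap.range T) :=
  Submodule.finiteDimensional_of_le (S₂ := V) (by rintro _ ⟨y, rfl⟩; exact h y)

theorem finiteDimensional_range_partialSum (x : ℕ → X) (f : ℕ → (X →L[ℂ] ℂ)) (m : ℕ) :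
    FiniteDimensional ℂ (LinearMap.range (partialSum x f m : X →ₗ[ℂ] X)) := by
  have : FiniteDimensional ℂ (Submodule.span ℂ (x '' (Finset.range m : Set ℕ))) :=
    FiniteDimensional.span_of_finite ℂ ((Finset.finite_toSet _).image _)
  refine finiteDimensional_range_of_forall_mem _
    (Submodule.span ℂ (x '' (Finset.range m : Set ℕ))) fun y => ?_
  change partialSum x f m y ∈ _
  rw [partialSum_apply]
  exact Submodule.sum_mem _ fun k hk =>
    Submodule.smul_mem _ _ (Submodule.subset_span ⟨k, hk, rfl⟩)

theorem HasCBFrame.hasCBAP (h : HasCBFrame X) : HasCBAP X := by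
  obtain ⟨x, f, h⟩ := h
  refine ⟨partialSum x f, finiteDimensional_range_partialSum x f, h.bounded, fun y => ?_⟩
  simpa only [partialSum_apply] using h.tendsto_sum y

theorem exists_coordinates {E F : Type*} [NormedAddCommGroup E] [NormedSpace ℂ E]
    [NormedAddCommGroup F] [NormedSpace ℂ F] (T : E →ₗ[ℂ] F) (hT : Continuous T)
    [FiniteDimensional ℂ (LinearMap.range T)] :
    ∃ (n : ℕ) (x : Fin n → F) (f : Fin n → E →ₗ[ℂ] ℂ), (∀ j, Continuous (f j)) ∧
      ∀ y, T y = ∑ j, f j y • x j := by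
  let b := Module.finBasis ℂ (LinearMap.range T)
  refine ⟨_, fun j => (b j : F), fun j => b.coord j ∘ₗ T.rangeRestrict, fun j => ?_, fun y => ?_⟩
  · exact (LinearMap.continuous_of_finiteDimensional (b.coord j)).comp (hT.subtype_mk _)
  · have h := congrArg (LinearMap.range T).subtype (b.sum_repr (T.rangeRestrict y))
    rw [map_sum] at h
    exact h.symm

/-- A continuous map of finite rank is a partial sum of rank one maps. -/
theorem exists_eq_partialSum (A : X →L[ℂ] X)
    (hA : FiniteDimensional ℂ (LinearMap.range (A : X →ₗ[ℂ] X))) :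
    ∃ (n : ℕ) (x : ℕ → X) (f : ℕ → (X →L[ℂ] ℂ)), 0 < n ∧ partialSum x f n = A := by
  obtain ⟨n, x, f, hf, h⟩ := exists_coordinates (E := X) (F := X)
    { toFun := A, map_add' := A.map_add, map_smul' := A.map_smul } A.continuous
  -- The extra zero term makes the length positive even for the zero map; blocks must be nonempty
  -- when concatenated.
  refine ⟨n + 1, fun j => if hj : j < n then x ⟨j, hj⟩ else 0,
    fun j => if hj : j < n then ⟨f ⟨j, hj⟩, hf _⟩ else 0, n.succ_pos, ?_⟩
  refine ContinuousLinearMap.ext fun y => ?_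
  rw [partialSum_apply, Finset.sum_range_succ, Finset.sum_range]
  refine Eq.trans ?_ (h y).symm
  simp

theorem sum_range_mod {E : Type*} [AddCommMonoid E] (g : ℕ → E) {n b : ℕ} (hb : b ≤ n) (a : ℕ) :
    ∑ q ∈ Finset.range (a * n + b), g (q % n) =
      a • ∑ q ∈ Finset.range n, g q + ∑ q ∈ Finset.range b, g q := by
  have key : ∀ b ≤ n, ∑ q ∈ Finset.range b, g (q % n) = ∑ q ∈ Finset.range b, g q :=
    fun b hb => Finset.sum_congr rfl fun q hq => by
      rw [Nat.mod_eq_of_lt (by rw [Finset.mem_range] at hq; omega)]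
  induction a with
  | zero => simp [key b hb]
  | succ a ih =>
    rw [show (a + 1) * n + b = n + (a * n + b) by ring, Finset.sum_range_add, key n le_rfl]
    simp_rw [Nat.add_mod_left]
    rw [ih, succ_nsmul', add_assoc]

/-- A finite rank map `A` is a finite sum of rank one maps whose partial sums are, up to a
completely bounded error of norm at most `ε`, multiples of `A` by numbers in `[0, 1]`. -/
theorem exists_splitting (A : X →L[ℂ] X)
    (hA : FiniteDimensional ℂ (LinearMap.range (A : X →ₗ[ℂ] X))) {ε : ℝ} (hε : 0 < ε) :
    ∃ (len : ℕ) (x : ℕ → X) (f : ℕ → (X →L[ℂ] ℂ)), 0 < len ∧ partialSum x f len = A ∧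
      ∀ p < len, ∃ (c : ℝ) (R : X →L[ℂ] X), 0 ≤ c ∧ c ≤ 1 ∧ CBNormLE R ε ∧
        partialSum x f p = (c : ℂ) • A + R := by
  obtain ⟨n, x, f, hn, rfl⟩ := exists_eq_partialSum A hA
  choose B hB hf using fun j => exists_bound (f j)
  -- With this `N`, any incomplete repetition, weighted by `1 / N`, has cb-norm at most `ε`.
  obtain ⟨N, hN⟩ := exists_nat_gt ((∑ j ∈ Finset.range n, B j * ‖x j‖) / ε)
  have hB0 : ∀ j, 0 ≤ B j * ‖x j‖ := fun j => mul_nonneg (hB j) (norm_nonneg _)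
  have hN0 : (0 : ℝ) < N := lt_of_le_of_lt (div_nonneg (Finset.sum_nonneg fun j _ => hB0 j) hε.le) hN
  have hNpos : 0 < N := by exact_mod_cast hN0
  have hsum : ∀ a b : ℕ, b ≤ n →
      partialSum (fun q => x (q % n)) (fun q => (N : ℂ)⁻¹ • f (q % n)) (a * n + b) =
        ((a / N : ℝ) : ℂ) • partialSum x f n + (N : ℂ)⁻¹ • partialSum x f b := by
    intro a b hb
    refine ContinuousLinearMap.ext fun y => ?_
    change _ = ((a / N : ℝ) : ℂ) • partialSum x f n y + (N : ℂ)⁻¹ • partialSum x f b y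
    simp only [partialSum_apply]
    change ∑ q ∈ Finset.range (a * n + b), ((N : ℂ)⁻¹ • f (q % n) y) • x (q % n) = _
    simp_rw [smul_assoc]
    rw [← Finset.smul_sum, sum_range_mod (fun q => f q y • x q) hb, smul_add,
      ← Nat.cast_smul_eq_nsmul ℂ, smul_smul]
    push_cast
    rw [div_eq_inv_mul]
  refine ⟨N * n, fun q => x (q % n), fun q => (N : ℂ)⁻¹ • f (q % n), Nat.mul_pos hNpos hn, ?_,
    fun p hp => ?_⟩
  · have h := hsum N 0 n.zero_le
    rw [add_zero, div_self hN0.ne'] at h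
    rw [h]
    refine ContinuousLinearMap.ext fun y => ?_
    change ((1 : ℝ) : ℂ) • partialSum x f n y + (N : ℂ)⁻¹ • partialSum x f 0 y = _
    simp [partialSum_apply]
  · have hlt : p % n < n := Nat.mod_lt _ hn
    -- At position `p` there are `p / n` complete repetitions, each contributing `A / N`; the
    -- remaining `p % n` terms form the error.
    refine ⟨(p / n : ℕ) / N, (N : ℂ)⁻¹ • partialSum x f (p % n), by positivity, ?_, ?_, ?_⟩
    · rw [div_le_one hN0]
      exact_mod_cast ((Nat.div_lt_iff_lt_mul hn).2 hp).le
    · have h1 : CBNormLE (partialSum x f (p % n)) (∑ j ∈ Finset.range (p % n), B j * ‖x j‖) :=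
        CBNormLE.sum fun j _ => cbNormLE_smulRight (hB j) (hf j) (x j)
      have h2 : ∑ j ∈ Finset.range (p % n), B j * ‖x j‖ ≤ ∑ j ∈ Finset.range n, B j * ‖x j‖ :=
        Finset.sum_le_sum_of_subset_of_nonneg (Finset.range_mono hlt.le) fun j _ _ => hB0 j
      refine ((h1.mono h2).smul _).mono ?_
      rw [norm_inv, Complex.norm_natCast, inv_mul_le_iff₀ hN0]
      exact ((div_lt_iff₀ hε).1 hN).le
    · rw [← hsum _ _ hlt.le, Nat.div_add_mod']

/-- The index in the concatenation of blocks of lengths `len 0, len 1, …`: block number and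
position in the block. -/
def blockIndex (len : ℕ → ℕ) : ℕ → ℕ × ℕ
  | 0 => (0, 0)
  | m + 1 =>
    if (blockIndex len m).2 + 1 < len (blockIndex len m).1 then
      ((blockIndex len m).1, (blockIndex len m).2 + 1)
    else ((blockIndex len m).1 + 1, 0)

theorem blockIndex_snd_lt {len : ℕ → ℕ} (hlen : ∀ k, 0 < len k) (m : ℕ) :
    (blockIndex len m).2 < len (blockIndex len m).1 := by
  cases m with
  | zero => exact hlen 0
  | succ m =>
    rw [blockIndex]
    split_ifs with h
    · exact h
    · exact hlen _

theorem sum_blockIndex {len : ℕ → ℕ} (hlen : ∀ k, 0 < len k) {E : Type*} [AddCommMonoid E]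
    (g : ℕ → ℕ → E) (m : ℕ) :
    ∑ i ∈ Finset.range m, g (blockIndex len i).1 (blockIndex len i).2 =
      ∑ k ∈ Finset.range (blockIndex len m).1, ∑ p ∈ Finset.range (len k), g k p +
        ∑ p ∈ Finset.range (blockIndex len m).2, g (blockIndex len m).1 p := by
  induction m with
  | zero => simp [blockIndex]
  | succ m ih =>
    rw [Finset.sum_range_succ, ih, add_assoc, ← Finset.sum_range_succ, blockIndex]
    split_ifs with h
    · rfl
    · have h1 := blockIndex_snd_lt hlen m
      rw [show (blockIndex len m).2 + 1 = len (blockIndex len m).1 by omega,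
        Finset.sum_range_succ]
      simp

/-- Summing the constant `1` in `sum_blockIndex` expresses `m` through block lengths; if the block
number were below `K`, then `m` would be less than the total length of the first `K` blocks. -/
theorem tendsto_blockIndex {len : ℕ → ℕ} (hlen : ∀ k, 0 < len k) :
    Tendsto (fun m => (blockIndex len m).1) atTop atTop := by
  refine tendsto_atTop.2 fun K => ?_
  filter_upwards [eventually_ge_atTop (∑ k ∈ Finset.range K, len k)] with m hm
  by_contra! hK
  have h1 := sum_blockIndex hlen (fun _ _ => 1) m
  simp only [Finset.sum_const, Finset.card_range, smul_eq_mul, mul_one] at h1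
  have h2 := blockIndex_snd_lt hlen m
  have h3 := Finset.sum_le_sum_of_subset (f := len) (Finset.range_mono (Nat.succ_le_of_lt hK))
  rw [Finset.sum_range_succ] at h3
  omega

theorem finiteDimensional_range_sub (Φ Ψ : X →L[ℂ] X)
    (hΦ : FiniteDimensional ℂ (LinearMap.range (Φ : X →ₗ[ℂ] X)))
    (hΨ : FiniteDimensional ℂ (LinearMap.range (Ψ : X →ₗ[ℂ] X))) :
    FiniteDimensional ℂ (LinearMap.range ((Φ - Ψ : X →L[ℂ] X) : X →ₗ[ℂ] X)) :=
  finiteDimensional_range_of_forall_mem _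
    (LinearMap.range (Φ : X →ₗ[ℂ] X) ⊔ LinearMap.range (Ψ : X →ₗ[ℂ] X)) fun y =>
      Submodule.sub_mem _ (Submodule.mem_sup_left ⟨y, rfl⟩) (Submodule.mem_sup_right ⟨y, rfl⟩)

theorem norm_smul_coe (c : ℂ) (y : X) : ‖c • y‖ = ‖c‖ * ‖y‖ :=
  norm_smul c (y : H →L[ℂ] H)

theorem HasCBAP.hasCBFrame (h : HasCBAP X) : HasCBFrame X := by
  obtain ⟨Φ, hfin, ⟨C, hC⟩, hlim⟩ := h
  -- Starting from `0` makes the differences telescope to `Ψ K` exactly.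
  obtain ⟨Ψ, hΨ0, hΨ⟩ : ∃ Ψ : ℕ → (X →L[ℂ] X), Ψ 0 = 0 ∧ ∀ k, Ψ (k + 1) = Φ k :=
    ⟨fun k => Nat.casesOn k 0 Φ, rfl, fun _ => rfl⟩
  have hΨfin : ∀ k, FiniteDimensional ℂ (LinearMap.range (Ψ k : X →ₗ[ℂ] X)) := by
    intro k
    cases k with
    | zero =>
      rw [hΨ0]
      exact finiteDimensional_range_of_forall_mem _ ⊥ fun y => Submodule.zero_mem _
    | succ k => rw [hΨ]; exact hfin k
  have hΨC : ∀ k, CBNormLE (Ψ k) |C| := by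
    intro k
    cases k with
    | zero => rw [hΨ0]; exact cbNormLE_zero.mono (abs_nonneg C)
    | succ k => rw [hΨ]; exact (hC k).mono (le_abs_self C)
  have hΨlim : ∀ y, Tendsto (fun k => Ψ k y) atTop (𝓝 y) := fun y =>
    (tendsto_add_atTop_iff_nat 1).1 (by simpa only [hΨ] using hlim y)
  have htele : ∀ K, ∑ k ∈ Finset.range K, (Ψ (k + 1) - Ψ k) = Ψ K := by
    intro K
    induction K with
    | zero => simp [hΨ0]
    | succ K ih =>
      rw [Finset.sum_range_succ, ih]
      exact ContinuousLinearMap.ext fun y => add_sub_cancel (Ψ K y) (Ψ (K + 1) y)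
  -- The error allowed in block `k`: at most `1`, for the uniform bound, and tending to `0`, for
  -- convergence.
  have hpos : ∀ k : ℕ, (0 : ℝ) < 1 / ((k : ℝ) + 1) := fun k => by positivity
  choose len x f hlen hA hsplit using fun k => exists_splitting (Ψ (k + 1) - Ψ k)
    (finiteDimensional_range_sub _ _ (hΨfin (k + 1)) (hΨfin k)) (hpos k)
  have key : ∀ m, ∃ (c : ℝ) (R : X →L[ℂ] X), 0 ≤ c ∧ c ≤ 1 ∧
      CBNormLE R (1 / (((blockIndex len m).1 : ℝ) + 1)) ∧
      partialSum (fun i => x (blockIndex len i).1 (blockIndex len i).2)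
        (fun i => f (blockIndex len i).1 (blockIndex len i).2) m =
      Ψ (blockIndex len m).1 +
        ((c : ℂ) • (Ψ ((blockIndex len m).1 + 1) - Ψ (blockIndex len m).1) + R) := by
    intro m
    obtain ⟨c, R, hc0, hc1, hR, h⟩ := hsplit _ _ (blockIndex_snd_lt hlen m)
    refine ⟨c, R, hc0, hc1, hR, ?_⟩
    rw [← h]
    refine (sum_blockIndex hlen (fun k p => (f k p).smulRight (x k p)) m).trans ?_
    refine congrArg₂ _ ?_ rfl
    refine (Finset.sum_congr rfl fun k _ => hA k).trans ?_
    exact htele _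
  have hc_norm : ∀ c : ℝ, 0 ≤ c → c ≤ 1 → ‖(c : ℂ)‖ ≤ 1 := fun c h0 h1 => by
    rwa [Complex.norm_real, Real.norm_of_nonneg h0]
  -- The bound adds the contributions of `Ψ k`, of `c • (Ψ (k + 1) - Ψ k)` and of the error `R`.
  refine ⟨fun i => x (blockIndex len i).1 (blockIndex len i).2,
    fun i => f (blockIndex len i).1 (blockIndex len i).2,
    ⟨fun y => ?_, |C| + (1 * (|C| + |C|) + 1), fun m => ?_⟩⟩
  · simp_rw [← partialSum_apply]
    let δ : ℕ → ℝ := fun k => ‖Ψ k y - y‖ + (‖Ψ (k + 1) y - Ψ k y‖ + 1 / ((k : ℝ) + 1) * ‖y‖)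
    have hδ : Tendsto δ atTop (𝓝 0) := by
      have h1 : Tendsto (fun k => ‖Ψ k y - y‖) atTop (𝓝 0) :=
        tendsto_iff_norm_sub_tendsto_zero.1 (hΨlim y)
      have h2 : Tendsto (fun k => ‖Ψ (k + 1) y - Ψ k y‖) atTop (𝓝 0) := by
        have := (((tendsto_add_atTop_iff_nat 1).2 (hΨlim y)).sub (hΨlim y)).norm
        simpa using this
      have h3 := (tendsto_one_div_add_atTop_nhds_zero_nat (𝕜 := ℝ)).mul_const ‖y‖
      have h4 := h1.add (h2.add h3)
      rwa [zero_mul, add_zero, add_zero] at h4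
    refine tendsto_iff_norm_sub_tendsto_zero.2 (squeeze_zero (fun _ => norm_nonneg _) (fun m => ?_)
      (hδ.comp (tendsto_blockIndex hlen)))
    obtain ⟨c, R, hc0, hc1, hR, h⟩ := key m
    rw [h]
    have hRy := hR.norm_apply_le (hpos _).le y
    have hcy : ‖(c : ℂ) • (Ψ ((blockIndex len m).1 + 1) y - Ψ (blockIndex len m).1 y)‖ ≤
        ‖Ψ ((blockIndex len m).1 + 1) y - Ψ (blockIndex len m).1 y‖ := by
      rw [norm_smul_coe]
      exact mul_le_of_le_one_left (norm_nonneg _) (hc_norm c hc0 hc1)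
    change ‖Ψ (blockIndex len m).1 y +
      ((c : ℂ) • (Ψ ((blockIndex len m).1 + 1) y - Ψ (blockIndex len m).1 y) + R y) - y‖ ≤ _
    rw [add_sub_right_comm]
    exact (norm_add_le _ _).trans (add_le_add le_rfl
      ((norm_add_le _ _).trans (add_le_add hcy hRy)))
  · obtain ⟨c, R, hc0, hc1, hR, h⟩ := key m
    rw [h]
    refine (hΨC _).add (CBNormLE.add (((hΨC _).sub (hΨC _)).smul _ |>.mono ?_) (hR.mono ?_))
    · exact mul_le_mul_of_nonneg_right (hc_norm c hc0 hc1) (by positivity)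
    · rw [div_le_one (by positivity)]
      linarith [(Nat.cast_nonneg (blockIndex len m).1 : (0 : ℝ) ≤ _)]

end OperatorSpace

/-! ### Fourier coefficients and Herz-Schur multipliers. -/

namespace ReducedGroup
open OperatorSpace

variable {G : Type u}

open Classical in
/-- The standard basis vector of `ℓ²(G)` at `t`. -/
def dirac (t : G) : ell2 G := lp.single 2 t 1

open Classical in
theorem dirac_apply (t r : G) : dirac t r = if r = t then 1 else 0 := by
  rw [dirac, lp.single_apply, Pi.single_apply]

theorem inner_dirac (t : G) (ξ : ell2 G) : inner ℂ (dirac t) ξ = ξ t := by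
  classical
  rw [dirac, lp.inner_single_left]
  simp

theorem hasSum_dirac (ξ : ell2 G) : HasSum (fun t => ξ t • dirac t) ξ := by
  classical
  convert lp.hasSum_single (p := 2) (by norm_num) ξ with t
  ext r
  simp [dirac_apply, Pi.single_apply]

theorem norm_sq_sum_dirac (F : Finset G) (α : F → ℂ) :
    ‖∑ t, α t • dirac (t : G)‖ ^ 2 = ∑ t, ‖α t‖ ^ 2 := by
  have ho : Orthonormal ℂ (fun t : F => dirac (t : G)) := by
    classical
    rw [orthonormal_iff_ite]
    intro i j
    rw [inner_dirac, dirac_apply]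
    by_cases h : i = j
    · simp [h]
    · rw [if_neg h, if_neg fun h' => h (Subtype.ext h')]
  rw [← Complex.ofReal_inj]
  have := ho.inner_sum α α Finset.univ
  rw [inner_self_eq_norm_sq_to_K] at this
  push_cast
  refine this.trans (Finset.sum_congr rfl fun t _ => ?_)
  exact Complex.conj_mul' _

/-- The matrix coefficient `y ↦ ⟨δ_r, y δ_t⟩` on `B(ℓ²(G))`. -/
def matrixCoeff (r t : G) : (ell2 G →L[ℂ] ell2 G) →L[ℂ] ℂ :=
  (innerSL ℂ (dirac r)).comp (ContinuousLinearMap.apply ℂ (ell2 G) (dirac t))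

theorem matrixCoeff_apply (r t : G) (y : ell2 G →L[ℂ] ell2 G) :
    matrixCoeff r t y = inner ℂ (dirac r) (y (dirac t)) := rfl

section FiniteVectors

variable {κ : Type*} [Fintype κ] {F : Finset G}

/-- The vector of `ℓ²(G)` with coordinates `α (j, t)`, `t ∈ F`. -/
def finVec (α : κ × F → ℂ) (j : κ) : ell2 G := ∑ t : F, α (j, t) • dirac (t : G)

theorem familyNorm_finVec (α : κ × F → ℂ) : familyNorm (finVec α) = familyNorm α := by
  refine familyNorm_congr ?_
  rw [Fintype.sum_prod_type]
  exact Finset.sum_congr rfl fun j _ => norm_sq_sum_dirac F _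

end FiniteVectors

variable [Group G]

theorem lam_dirac (s t : G) : lam s (dirac t) = dirac (s * t) := by
  classical
  ext r
  rw [lam_apply, dirac_apply, dirac_apply]
  simp [inv_mul_eq_iff_eq_mul]

theorem inner_lam (s : G) (η ξ : ell2 G) :
    inner ℂ η (lam s ξ) = inner ℂ (lam s⁻¹ η) ξ := by
  rw [lp.inner_eq_tsum, lp.inner_eq_tsum, ← (Equiv.mulLeft s).tsum_eq]
  simp [lam_apply]

theorem lam_mul_apply (s t : G) (ξ : ell2 G) : lam (s * t) ξ = lam s (lam t ξ) := by
  ext r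
  simp [lam_apply, mul_assoc]

theorem lam_one_apply (ξ : ell2 G) : lam 1 ξ = ξ := by
  ext r
  simp [lam_apply]

theorem norm_lam (s : G) (ξ : ell2 G) : ‖lam s ξ‖ = ‖ξ‖ := by
  rw [@norm_eq_sqrt_re_inner ℂ, @norm_eq_sqrt_re_inner ℂ _ _ _ _ ξ, inner_lam, ← lam_mul_apply,
    inv_mul_cancel, lam_one_apply]

open Classical in
theorem matrixCoeff_lam (r t s : G) : matrixCoeff r t (lam s) = if r = s * t then 1 else 0 := by
  rw [matrixCoeff_apply, lam_dirac, inner_dirac, dirac_apply]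

/-- The Fourier coefficient at `s` of an element of the reduced group C*-algebra. -/
def coeff (s : G) : reducedCStar G →L[ℂ] ℂ :=
  (matrixCoeff s 1).comp (reducedCStar G).subtypeL

theorem coeff_apply (s : G) (y : reducedCStar G) :
    coeff s y = inner ℂ (dirac s) ((y : ell2 G →L[ℂ] ell2 G) (dirac 1)) := rfl

open Classical in
theorem coeff_lamC (s t : G) : coeff s (lamC t) = if s = t then 1 else 0 := by
  have := matrixCoeff_lam s 1 t
  rwa [mul_one] at this

/-- Each `lam s` has a matrix constant along the sets where `r * t⁻¹` is fixed, a closed linear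
condition that passes to the closure of the span. -/
theorem inner_apply_dirac (y : reducedCStar G) (r t : G) :
    inner ℂ (dirac r) ((y : ell2 G →L[ℂ] ell2 G) (dirac t)) = coeff (r * t⁻¹) y := by
  have h : reducedCStar G ≤ LinearMap.ker
      (matrixCoeff r t - matrixCoeff (r * t⁻¹) 1 : (ell2 G →L[ℂ] ell2 G) →L[ℂ] ℂ).toLinearMap := by
    refine Submodule.topologicalClosure_minimal _ (Submodule.span_le.2 ?_)
      (ContinuousLinearMap.isClosed_ker _)
    rintro _ ⟨s, rfl⟩
    change matrixCoeff r t (lam s) - matrixCoeff (r * t⁻¹) 1 (lam s) = 0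
    classical
    rw [matrixCoeff_lam, matrixCoeff_lam]
    simp [mul_inv_eq_iff_eq_mul]
  exact sub_eq_zero.1 (h y.2)

theorem norm_coeff_le (s : G) (y : reducedCStar G) : ‖coeff s y‖ ≤ ‖y‖ := by
  have h1 : ∀ t : G, ‖dirac t‖ = 1 := fun t => by
    rw [@norm_eq_sqrt_re_inner ℂ, inner_dirac, dirac_apply]
    simp
  rw [coeff_apply]
  refine (norm_inner_le_norm _ _).trans ?_
  rw [h1, one_mul]
  refine ((y : ell2 G →L[ℂ] ell2 G).le_opNorm _).trans ?_
  rw [h1, mul_one]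
  rfl

variable (G) in
/-- The span of the operators `lam s` in the reduced group C*-algebra. -/
def groupSpan : Submodule ℂ (reducedCStar G) := Submodule.span ℂ (Set.range lamC)

theorem mem_closure_groupSpan (y : reducedCStar G) :
    y ∈ closure (groupSpan G : Set (reducedCStar G)) := by
  rw [closure_subtype]
  have h : (groupSpan G).map (reducedCStar G).subtype = Submodule.span ℂ (Set.range lam) := by
    rw [groupSpan, Submodule.map_span, ← Set.range_comp]
    rfl
  have h2 := congrArg (fun V : Submodule ℂ (ell2 G →L[ℂ] ell2 G) => (V : Set (ell2 G →L[ℂ] ell2 G))) h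
  exact (congrArg (fun S => (y : ell2 G →L[ℂ] ell2 G) ∈ closure S) h2).mpr y.2

theorem mem_of_isClosed {W : Submodule ℂ (reducedCStar G)}
    (hW : IsClosed (W : Set (reducedCStar G))) (h : ∀ s, lamC s ∈ W) (y : reducedCStar G) :
    y ∈ W := by
  have h1 : groupSpan G ≤ W := Submodule.span_le.2 (by rintro _ ⟨s, rfl⟩; exact h s)
  exact closure_minimal h1 hW (mem_closure_groupSpan y)

theorem finite_support_coeff {y : reducedCStar G} (hy : y ∈ groupSpan G) :
    (Function.support fun s => coeff s y).Finite := by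
  classical
  induction hy using Submodule.span_induction with
  | mem y h =>
    obtain ⟨t, rfl⟩ := h
    refine (Set.finite_singleton t).subset fun s hs => ?_
    simpa [coeff_lamC] using hs
  | zero => simp
  | add y z _ _ hy hz =>
    refine (hy.union hz).subset fun s hs => ?_
    by_contra! h
    simp only [Set.mem_union, Function.mem_support, not_or, not_not] at h
    exact hs (by simp [h.1, h.2])
  | smul c y _ hy =>
    refine hy.subset fun s hs h => hs ?_
    simp only at h
    simp [h]

section Multiplier

variable {κ : Type*} [Fintype κ] {F : Finset G}

theorem sum_inner_finVec (a : Matrix κ κ (reducedCStar G)) (α β : κ × F → ℂ) :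
    ∑ i, ∑ j, inner ℂ (finVec β i) (coeMatrix a i j (finVec α j)) =
      ∑ p, ∑ q, star (β p) * α q * coeff ((p.2 : G) * (q.2 : G)⁻¹) (a p.1 q.1) := by
  rw [Fintype.sum_prod_type]
  refine Finset.sum_congr rfl fun i _ => ?_
  simp_rw [Fintype.sum_prod_type]
  rw [Finset.sum_comm]
  refine Finset.sum_congr rfl fun j _ => ?_
  rw [finVec, finVec, sum_inner]
  refine Finset.sum_congr rfl fun r _ => ?_
  rw [map_sum, inner_sum]
  refine Finset.sum_congr rfl fun t _ => ?_
  rw [map_smul, inner_smul_left, inner_smul_right, ← inner_apply_dirac, mul_assoc]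
  rfl

/-- The matrix `[⟨δ_r, x i j δ_t⟩ lam (r t⁻¹)]`, whose norm is at most that of `x`. -/
def twistedMatrix (x : Matrix κ κ (reducedCStar G)) (F : Finset G) :
    Matrix (κ × F) (κ × F) (reducedCStar G) := fun p q =>
  coeff ((p.2 : G) * (q.2 : G)⁻¹) (x p.1 q.1) • lamC ((p.2 : G) * (q.2 : G)⁻¹)

theorem formBound_twistedMatrix {x : Matrix κ κ (reducedCStar G)} {K : ℝ} (hK : 0 ≤ K)
    (hx : FormBound (coeMatrix x) K) (F : Finset G) :
    FormBound (coeMatrix (twistedMatrix x F)) K := by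
  intro ξ η
  -- The entries are those of `x` compressed to finitely supported vectors. Since `⟨η, λ_{r t⁻¹} ξ⟩
  -- = ⟨λ_{r⁻¹} η, λ_{t⁻¹} ξ⟩`, the operators `λ_{r t⁻¹}` are absorbed into the vectors without
  -- changing their norms.
  have h := scalar_amplification
    (fun p q : κ × F => coeff ((p.2 : G) * (q.2 : G)⁻¹) (x p.1 q.1)) hK (fun α β => by
      have := hx (finVec α) (finVec β)
      rwa [sum_inner_finVec, familyNorm_finVec, familyNorm_finVec] at this)
    (fun q => lam (q.2 : G)⁻¹ (ξ q)) (fun p => lam (p.2 : G)⁻¹ (η p))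
  have hn : ∀ ζ : κ × F → ell2 G, familyNorm (fun q => lam (q.2 : G)⁻¹ (ζ q)) = familyNorm ζ :=
    fun ζ => familyNorm_congr (by simp_rw [norm_lam])
  rw [hn, hn] at h
  refine le_of_eq_of_le (congrArg _ ?_) h
  refine Finset.sum_congr rfl fun p _ => Finset.sum_congr rfl fun q _ => ?_
  change inner ℂ (η p) (coeff ((p.2 : G) * (q.2 : G)⁻¹) (x p.1 q.1) •
    lam ((p.2 : G) * (q.2 : G)⁻¹) (ξ q)) = _
  rw [inner_smul_right, lam_mul_apply, inner_lam]

end Multiplier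

/-- The multiplier `y ↦ ∑_{s ∈ S} φ(s) coeff s y lam s`. -/
def finMultiplier (φ : G → ℂ) (S : Finset G) : reducedCStar G →L[ℂ] reducedCStar G :=
  ∑ s ∈ S, (φ s • coeff s).smulRight (lamC s)

theorem finMultiplier_apply (φ : G → ℂ) (S : Finset G) (y : reducedCStar G) :
    finMultiplier φ S y = ∑ s ∈ S, (φ s * coeff s y) • lamC s := by
  simp [finMultiplier, sum_apply]

theorem finMultiplier_lamC {φ : G → ℂ} {S : Finset G} (hS : Function.support φ ⊆ S) (s : G) :
    finMultiplier φ S (lamC s) = φ s • lamC s := by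
  classical
  rw [finMultiplier_apply, Finset.sum_eq_single s]
  · simp [coeff_lamC]
  · intro t _ ht
    simp [coeff_lamC, ht]
  · intro hs
    have : φ s = 0 := by
      by_contra h
      exact hs (hS h)
    simp [this]

theorem coeff_finMultiplier {φ : G → ℂ} {S : Finset G} (hS : Function.support φ ⊆ S) (s : G)
    (y : reducedCStar G) : coeff s (finMultiplier φ S y) = φ s * coeff s y := by
  classical
  rw [finMultiplier_apply, map_sum, Finset.sum_eq_single s]
  · simp [coeff_lamC]
  · intro t _ ht
    simp [coeff_lamC, ht.symm]
  · intro hs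
    have : φ s = 0 := by
      by_contra h
      exact hs (hS h)
    simp [this]

theorem continuous_familyNorm {ι E : Type*} [Fintype ι] [NormedAddCommGroup E] :
    Continuous (familyNorm : (ι → E) → ℝ) := by
  unfold familyNorm
  fun_prop

/-- A bound on the sesquilinear form of a matrix need only be checked on finitely supported
vectors. -/
theorem formBound_of_finVec {κ : Type*} [Fintype κ] {a : Matrix κ κ (reducedCStar G)} {K : ℝ}
    (h : ∀ (F : Finset G) (α β : κ × F → ℂ),
      ‖∑ p, ∑ q, star (β p) * α q * coeff ((p.2 : G) * (q.2 : G)⁻¹) (a p.1 q.1)‖ ≤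
        K * (familyNorm α * familyNorm β)) : FormBound (coeMatrix a) K := by
  intro ξ η
  -- Truncations to `F` converge to the vector, and both sides of the bound are continuous.
  let T : (κ → ell2 G) → Finset G → κ → ell2 G := fun ζ F =>
    finVec (F := F) fun p => ζ p.1 (p.2 : G)
  have hT : ∀ ζ, Tendsto (T ζ) atTop (𝓝 ζ) := by
    intro ζ
    refine tendsto_pi_nhds.2 fun i => ?_
    refine Tendsto.congr (fun F => ?_) (hasSum_dirac (ζ i))
    exact (Finset.sum_coe_sort F fun t => ζ i t • dirac t).symm
  have hT' : ∀ ζ i, Tendsto (fun F => T ζ F i) atTop (𝓝 (ζ i)) := fun ζ i =>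
    tendsto_pi_nhds.1 (hT ζ) i
  have h1 : Tendsto (fun F => ‖∑ i, ∑ j, inner ℂ (T η F i) (coeMatrix a i j (T ξ F j))‖) atTop
      (𝓝 ‖∑ i, ∑ j, inner ℂ (η i) (coeMatrix a i j (ξ j))‖) :=
    (tendsto_finsetSum _ fun i _ => tendsto_finsetSum _ fun j _ =>
      (hT' η i).inner (((coeMatrix a i j).continuous.tendsto _).comp (hT' ξ j))).norm
  have h2 : ∀ ζ : κ → ell2 G, Tendsto (fun F => familyNorm (T ζ F)) atTop (𝓝 (familyNorm ζ)) :=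
    fun ζ => (continuous_familyNorm.tendsto _).comp (hT ζ)
  refine le_of_tendsto_of_tendsto' h1 (((h2 ξ).mul (h2 η)).const_mul K) fun F => ?_
  rw [sum_inner_finVec, familyNorm_finVec, familyNorm_finVec]
  exact h F _ _

/-- Averaging a completely bounded map on the reduced group C*-algebra gives a Herz-Schur
multiplier of at most the same norm. -/
theorem multiplierNormLE_of_cbNormLE {Φ : reducedCStar G →L[ℂ] reducedCStar G} {C : ℝ}
    (hΦ : CBNormLE Φ C) (hC : 0 ≤ C)
    (hfin : (Function.support fun s => coeff s (Φ (lamC s))).Finite) :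
    MultiplierNormLE (fun s => coeff s (Φ (lamC s))) C := by
  have hS : (Function.support fun s => coeff s (Φ (lamC s))) ⊆ (hfin.toFinset : Set G) := by simp
  refine ⟨finMultiplier _ hfin.toFinset, finMultiplier_lamC hS, fun n x => ?_⟩
  have hx := matrixNorm_nonneg x
  refine (matrixNorm_le_iff _ (by positivity)).2 (formBound_of_finVec fun F α β => ?_)
  -- On basis vectors, `⟨δ_r, Φ (λ_{r t⁻¹}) δ_t⟩` equals `φ (r t⁻¹)`, so the form of the image of
  -- the twisted matrix is that of the multiplier applied to `x`.
  have h := hΦ.formBound hC hx (formBound_twistedMatrix hx (formBound_matrixNorm x) F)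
    (fun q => α q • dirac (q.2 : G)) (fun p => β p • dirac (p.2 : G))
  have hn : ∀ ζ : Fin n × F → ℂ, familyNorm (fun q => ζ q • dirac (q.2 : G)) = familyNorm ζ := by
    intro ζ
    refine familyNorm_congr (Finset.sum_congr rfl fun q _ => ?_)
    have h1 : ‖dirac (q.2 : G)‖ = 1 := by
      rw [@norm_eq_sqrt_re_inner ℂ, inner_dirac, dirac_apply]
      simp
    rw [norm_smul, h1, mul_one]
  rw [hn, hn] at h
  refine le_of_eq_of_le (congrArg _ ?_) h
  refine Finset.sum_congr rfl fun p _ => Finset.sum_congr rfl fun q _ => ?_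
  rw [Matrix.map_apply, coeff_finMultiplier hS]
  change _ = inner ℂ (β p • dirac (p.2 : G))
    ((Φ (coeff ((p.2 : G) * (q.2 : G)⁻¹) (x p.1 q.1) • lamC ((p.2 : G) * (q.2 : G)⁻¹)) :
      ell2 G →L[ℂ] ell2 G) (α q • dirac (q.2 : G)))
  rw [map_smul, inner_smul_left, inner_smul_right, inner_apply_dirac, map_smul, map_smul,
    smul_eq_mul, mul_assoc, mul_comm (coeff _ (x _ _))]
  rfl

end ReducedGroup

/-! ### Weak amenability and the CBAP of the reduced group C*-algebra. -/

namespace ReducedGroup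
open OperatorSpace

variable {G : Type u} [Group G]

theorem exists_mem_groupSpan_norm_sub_lt (y : reducedCStar G) {ε : ℝ} (hε : 0 < ε) :
    ∃ z ∈ groupSpan G, ‖y - z‖ < ε := by
  obtain ⟨z, hz, h⟩ := Metric.mem_closure_iff.1 (mem_closure_groupSpan y) ε hε
  exact ⟨z, hz, by rwa [dist_eq_norm] at h⟩

/-- A finite rank map is, up to a completely bounded error of norm at most `ε`, a finite rank map
with values of uniformly finite support. -/
theorem exists_finite_support_approx (Φ : reducedCStar G →L[ℂ] reducedCStar G)
    (hΦ : FiniteDimensional ℂ (LinearMap.range (Φ : reducedCStar G →ₗ[ℂ] reducedCStar G)))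
    {ε : ℝ} (hε : 0 < ε) :
    ∃ R : reducedCStar G →L[ℂ] reducedCStar G, CBNormLE R ε ∧
      (Function.support fun s => coeff s ((Φ - R) (lamC s))).Finite := by
  obtain ⟨n, x, f, hn, rfl⟩ := exists_eq_partialSum Φ hΦ
  choose B hB hf using fun j => exists_bound (f j)
  have hn' : (0 : ℝ) < n := by exact_mod_cast hn
  -- Each of the `n` rank one errors gets the share `ε / n`; `B j + 1` avoids dividing by zero.
  have hδ : ∀ j, 0 < ε / (n * (B j + 1)) := fun j =>
    div_pos hε (mul_pos hn' (by linarith [hB j]))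
  choose z hz hxz using fun j => exists_mem_groupSpan_norm_sub_lt (x j) (hδ j)
  -- Subtracting this error leaves `∑ z j ⊗ f j`, whose values have coefficients supported in the
  -- union of the finite supports of the `z j`.
  refine ⟨partialSum (fun j => x j - z j) f n, ?_, ?_⟩
  · have h : CBNormLE (partialSum (fun j => x j - z j) f n)
        (∑ j ∈ Finset.range n, B j * ‖x j - z j‖) :=
      CBNormLE.sum fun j _ => cbNormLE_smulRight (hB j) (hf j) (x j - z j)
    refine h.mono ?_
    calc _ ≤ ∑ j ∈ Finset.range n, ε / n := by
          refine Finset.sum_le_sum fun j _ => ?_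
          have h1 : 0 < B j + 1 := by linarith [hB j]
          calc B j * ‖x j - z j‖ ≤ (B j + 1) * (ε / (n * (B j + 1))) :=
                mul_le_mul (by linarith) (hxz j).le (norm_nonneg _) h1.le
            _ = ε / n := by field_simp
      _ = ε := by
          rw [Finset.sum_const, Finset.card_range, nsmul_eq_mul, mul_div_cancel₀ _ hn'.ne']
  · refine Set.Finite.subset (Set.Finite.biUnion (Finset.finite_toSet (Finset.range n))
      fun j _ => finite_support_coeff (hz j)) fun s hs => ?_
    by_contra h
    simp only [Set.mem_iUnion, Function.mem_support, not_exists, not_not] at h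
    refine hs ?_
    have h1 : (partialSum x f n - partialSum (fun j => x j - z j) f n) (lamC s) =
        ∑ j ∈ Finset.range n, f j (lamC s) • z j := by
      change partialSum x f n (lamC s) - partialSum (fun j => x j - z j) f n (lamC s) = _
      rw [partialSum_apply, partialSum_apply, ← Finset.sum_sub_distrib]
      refine Finset.sum_congr rfl fun j _ => ?_
      rw [smul_sub, sub_sub_cancel]
    change coeff s ((partialSum x f n - partialSum (fun j => x j - z j) f n) (lamC s)) = 0
    rw [h1, map_sum]
    refine Finset.sum_eq_zero fun j hj => ?_
    rw [map_smul, h j hj, smul_zero]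

theorem isWeaklyAmenable_of_hasCBAP (h : HasCBAP (reducedCStar G)) : IsWeaklyAmenable G := by
  obtain ⟨Φ, hfin, ⟨C, hC⟩, hlim⟩ := h
  have hpos : ∀ k : ℕ, (0 : ℝ) < 1 / ((k : ℝ) + 1) := fun k => by positivity
  choose R hR hsupp using fun k => exists_finite_support_approx (Φ k) (hfin k) (hpos k)
  -- The index type of the net must live in the universe of `G`.
  refine ⟨ULift ℕ, inferInstance, inferInstance, inferInstance,
    fun k s => coeff s ((Φ k.down - R k.down) (lamC s)), fun k => hsupp k.down,
    ⟨|C| + 1, fun k => ?_⟩, fun s => ?_⟩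
  · refine multiplierNormLE_of_cbNormLE (((hC _).mono (le_abs_self C)).sub ((hR _).mono ?_))
      (by positivity) (hsupp _)
    rw [div_le_one (by positivity)]
    linarith [(Nat.cast_nonneg k.down : (0 : ℝ) ≤ _)]
  · have hdown : Tendsto (ULift.down : ULift.{u} ℕ → ℕ) atTop atTop :=
      tendsto_atTop.2 fun K => (eventually_ge_atTop (ULift.up K)).mono fun _ h => h
    suffices h : Tendsto (fun k : ℕ => coeff s ((Φ k - R k) (lamC s))) atTop (𝓝 1) from
      h.comp hdown
    have h1 : Tendsto (fun k => coeff s (Φ k (lamC s))) atTop (𝓝 1) := by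
      have := ((coeff s).continuous.tendsto _).comp (hlim (lamC s))
      classical
      rwa [coeff_lamC, if_pos rfl] at this
    have h2 : Tendsto (fun k => coeff s (R k (lamC s))) atTop (𝓝 0) := by
      have h3 := (tendsto_one_div_add_atTop_nhds_zero_nat (𝕜 := ℝ)).mul_const ‖lamC s‖
      rw [zero_mul] at h3
      exact squeeze_zero_norm (fun k => (norm_coeff_le s _).trans
        ((hR k).norm_apply_le (hpos k).le _)) h3
    have h4 := h1.sub h2
    rw [sub_zero] at h4
    refine h4.congr fun k => ?_
    exact (map_sub (coeff s) _ _).symm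

/-- The span of the `lamC s` with `φ s ≠ 0` is finite-dimensional, hence closed, so containing every
`M (lamC s)` it contains the whole range by density. -/
theorem finiteDimensional_range_of_multiplier {φ : G → ℂ} (hφ : (Function.support φ).Finite)
    {M : reducedCStar G →L[ℂ] reducedCStar G} (hM : ∀ s, M (lamC s) = φ s • lamC s) :
    FiniteDimensional ℂ (LinearMap.range (M : reducedCStar G →ₗ[ℂ] reducedCStar G)) := by
  let V : Submodule ℂ (reducedCStar G) := Submodule.span ℂ (lamC '' Function.support φ)
  have : FiniteDimensional ℂ V := FiniteDimensional.span_of_finite ℂ (hφ.image _)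
  have hV : IsClosed (V : Set (reducedCStar G)) := V.closed_of_finiteDimensional
  refine finiteDimensional_range_of_forall_mem _ V fun y => ?_
  refine mem_of_isClosed (W := V.comap (M : reducedCStar G →ₗ[ℂ] reducedCStar G))
    (hV.preimage M.continuous) (fun s => ?_) y
  change M (lamC s) ∈ V
  rw [hM]
  by_cases hs : φ s = 0
  · rw [hs, zero_smul]
    exact V.zero_mem
  · exact V.smul_mem _ (Submodule.subset_span ⟨s, hs, rfl⟩)

/-- The vectors on which a bounded sequence of maps converges to the identity form a closed
set. -/
theorem isClosed_tendsto_id {E : Type*} [NormedAddCommGroup E] (T : ℕ → E → E)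
    (hsub : ∀ k y z, T k (y - z) = T k y - T k z) {C : ℝ} (hC : 0 ≤ C)
    (hT : ∀ k y, ‖T k y‖ ≤ C * ‖y‖) : IsClosed {y | Tendsto (fun k => T k y) atTop (𝓝 y)} := by
  refine isClosed_of_closure_subset fun y hy => Metric.tendsto_atTop.2 fun ε hε => ?_
  -- Replacing `y` by `z` costs `C * ‖y - z‖` under `T k` and `‖y - z‖` under the identity, together
  -- less than `ε / 2`.
  obtain ⟨z, hz, hyz⟩ := Metric.mem_closure_iff.1 hy (ε / (2 * (C + 1))) (by positivity)
  obtain ⟨N, hN⟩ := Metric.tendsto_atTop.1 hz (ε / 2) (by positivity)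
  refine ⟨N, fun k hk => ?_⟩
  rw [dist_eq_norm] at hyz ⊢
  have h1 := hN k hk
  rw [dist_eq_norm] at h1
  have h2 : (C + 1) * ‖y - z‖ < ε / 2 := by
    rw [lt_div_iff₀ (by positivity)] at hyz ⊢
    linarith
  calc ‖T k y - y‖ = ‖T k (y - z) + (T k z - z) - (y - z)‖ := by rw [hsub]; congr 1; abel
    _ ≤ ‖T k (y - z)‖ + ‖T k z - z‖ + ‖y - z‖ :=
      (norm_sub_le _ _).trans (add_le_add (norm_add_le _ _) le_rfl)
    _ < ε := by linarith [hT k (y - z)]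

theorem tendsto_of_forall_lamC {M : ℕ → reducedCStar G →L[ℂ] reducedCStar G} {C : ℝ}
    (hC : 0 ≤ C) (hM : ∀ k, CBNormLE (M k) C)
    (h : ∀ s, Tendsto (fun k => M k (lamC s)) atTop (𝓝 (lamC s))) (y : reducedCStar G) :
    Tendsto (fun k => M k y) atTop (𝓝 y) := by
  let W : Submodule ℂ (reducedCStar G) :=
    { carrier := {y | Tendsto (fun k => M k y) atTop (𝓝 y)}
      add_mem' := fun {y z} hy hz => (Tendsto.add hy hz).congr fun k => (map_add (M k) y z).symm
      zero_mem' := tendsto_const_nhds.congr fun k => (map_zero (M k)).symm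
      smul_mem' := fun c y hy => (Tendsto.const_smul hy c).congr fun k => (map_smul (M k) c y).symm }
  have hW : IsClosed (W : Set (reducedCStar G)) :=
    isClosed_tendsto_id (fun k => M k) (fun k => map_sub (M k)) hC
      fun k => (hM k).norm_apply_le hC
  exact mem_of_isClosed hW h y

theorem IsWeaklyAmenable.hasCBAP [Countable G] (h : IsWeaklyAmenable G) :
    HasCBAP (reducedCStar G) := by
  obtain ⟨I, _, _, _, φ, hfin, ⟨C, hC⟩, hlim⟩ := h
  obtain ⟨e, he⟩ := exists_surjective_nat G
  -- A diagonal choice: at stage `k` only `e 0, …, e k` are controlled, finitely many eventual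
  -- conditions on the net.
  have hi : ∀ k : ℕ, ∃ i, ∀ j ∈ Finset.range (k + 1), ‖φ i (e j) - 1‖ < 1 / ((k : ℝ) + 1) := by
    intro k
    refine ((eventually_all_finset _).2 fun j _ => ?_ :
      ∀ᶠ i in atTop, ∀ j ∈ Finset.range (k + 1), ‖φ i (e j) - 1‖ < 1 / ((k : ℝ) + 1)).exists
    have h1 := tendsto_iff_norm_sub_tendsto_zero.1 (hlim (e j))
    exact h1.eventually_lt_const (by positivity)
  choose i hi using hi
  choose M hM hMC using fun k => hC (i k)
  refine ⟨M, fun k => finiteDimensional_range_of_multiplier (hfin _) (hM k), ⟨C, hMC⟩,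
    tendsto_of_forall_lamC (abs_nonneg C) (fun k => (hMC k).mono (le_abs_self C)) fun s => ?_⟩
  have h1 : Tendsto (fun k => φ (i k) s) atTop (𝓝 1) := by
    obtain ⟨j, rfl⟩ := he s
    refine tendsto_iff_norm_sub_tendsto_zero.2 (squeeze_zero' (.of_forall fun _ => norm_nonneg _)
      ?_ (tendsto_one_div_add_atTop_nhds_zero_nat (𝕜 := ℝ)))
    filter_upwards [eventually_ge_atTop j] with k hk
    exact (hi k j (Finset.mem_range.2 (Nat.lt_succ_of_le hk))).le
  have h2 := h1.smul_const (lamC s)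
  rw [one_smul] at h2
  exact h2.congr fun k => (hM k s).symm

end ReducedGroup

end

theorem mainTheorem7 (G : Type*) [Group G] [Countable G] :
    (ReducedGroup.IsWeaklyAmenable G ↔
      OperatorSpace.HasCBFrame (ReducedGroup.reducedCStar G)) ∧
    (ReducedGroup.IsWeaklyAmenable G ↔
      OperatorSpace.HasCBAP (ReducedGroup.reducedCStar G)) :=
  ⟨⟨fun h => h.hasCBAP.hasCBFrame, fun h => ReducedGroup.isWeaklyAmenable_of_hasCBAP h.hasCBAP⟩,
    fun h => h.hasCBAP, ReducedGroup.isWeaklyAmenable_of_hasCBAP⟩
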